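/- Let $(\Omega,\mathcal F,(\mathcal F_t)_{t\in[0,T]},Q)$ be a filtered probability space, $0\le T<\infty$, let $B:[0,T]\to\mathbb R$ be a non-decreasing (deterministic) function with $B_0=1$, and let $X=(X_t)_{t\in[0,T]}$ be a process with values in $[0,\infty)$, with discounted process $\overline X_t=B_t^{-1}X_t$. Let $f:[0,\infty)\to\mathbb R$ be a payoff function with $f(X_T)\in L^1(Q)$. The discounted values at time $t\in[0,T]$ of the European and of the American option with payoff $f$ and maturity $T$ are $$V_t^f=B_T^{-1}E_Q[f(X_T)\mid\mathcal F_t],\qquad V_t^{f,A}=\operatorname*{ess\,sup}_{\tau}E_Q[B_\tau^{-1}f(X_\tau)\mid\mathcal F_t],$$ the essential supremum being over all $(\mathcal F_s)$-stopping times $\tau$ with values in $[t,T]$. Assume that $f$ is convex and that $\overline X$ is a $Q$-submartingale whose paths are almost surely right-continuous. Then $B_\tau^{-1}f(X_\tau)$ is $Q$-integrable for all these $\tau$, and for every $t\in[0,T]$, $Q$-almost surely, $$V_t^{f,A}\le V_t^f+f(0)_+\,(B_t^{-1}-B_T^{-1})+f'_+(0)_-\,\bigl(\overline X_t-E_Q[\overline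 X_T\mid\mathcal F_t]\bigr).$$ Here $A_+=\max(0,A)$, $A_-=\min(0,A)$, and $f'_+(0)=\lim_{x\downarrow0}(f(x)-f(0))/x\in[-\infty,\infty)$ is the right derivative of $f$ at $0$; if it is $-\infty$, the right-hand side is read in $[-\infty,\infty]$ with $0\cdot(-\infty)=0$. -/

import Mathlib

open MeasureTheory Filter Topology Set

noncomputable section

namespace AmericanOption

section EssentialSupremum

variable {Ω : Type*} {mΩ : MeasurableSpace Ω}

/-- `V` is an essential supremum of the family `S` of extended real random variables: `V` is
measurable, it dominates every member of `S` almost surely, and it is almost surely below every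
measurable function with that property. Such a `V` is unique up to almost sure equality. -/
def IsEssSup (μ : Measure Ω) (S : Set (Ω → EReal)) (V : Ω → EReal) : Prop :=
  Measurable V ∧ (∀ Y ∈ S, Y ≤ᵐ[μ] V) ∧
    ∀ W : Ω → EReal, Measurable W → (∀ Y ∈ S, Y ≤ᵐ[μ] W) → V ≤ᵐ[μ] W

/-- A strictly increasing map of the extended reals into `[0, 1]`. -/
def squash (x : EReal) : ENNReal :=
  ENNReal.ofReal (ENNReal.orderIsoUnitIntervalBirational (EReal.expOrderIso x) : ℝ)

theorem squash_strictMono : StrictMono squash := by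
  intro x y hxy
  have h : ENNReal.orderIsoUnitIntervalBirational (EReal.expOrderIso x) <
      ENNReal.orderIsoUnitIntervalBirational (EReal.expOrderIso y) := by simpa using hxy
  have h' : (ENNReal.orderIsoUnitIntervalBirational (EReal.expOrderIso x) : ℝ) <
      ENNReal.orderIsoUnitIntervalBirational (EReal.expOrderIso y) := h
  exact (ENNReal.ofReal_lt_ofReal_iff_of_nonneg
    (ENNReal.orderIsoUnitIntervalBirational (EReal.expOrderIso x)).2.1).2 h'

theorem squash_le_one (x : EReal) : squash x ≤ 1 := by
  unfold squash
  exact ENNReal.ofReal_le_one.2 (ENNReal.orderIsoUnitIntervalBirational (EReal.expOrderIso x)).2.2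

/-- Every family of measurable extended real functions on a finite measure space has an essential
supremum. -/
theorem exists_isEssSup (μ : Measure Ω) [IsFiniteMeasure μ] (S : Set (Ω → EReal))
    (hS : ∀ Y ∈ S, Measurable Y) : ∃ V, IsEssSup μ S V := by
  let sup : Set (Ω → EReal) → Ω → EReal := fun C ω => ⨆ Y ∈ C, Y ω
  let I : Set (Ω → EReal) → ENNReal := fun C => ∫⁻ ω, squash (sup C ω) ∂μ
  have sup_mono : ∀ C D : Set (Ω → EReal), C ⊆ D → ∀ ω, sup C ω ≤ sup D ω :=
    fun C D h ω => biSup_mono (fun Y hY => h hY)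
  have I_mono : ∀ C D : Set (Ω → EReal), C ⊆ D → I C ≤ I D :=
    fun C D h => lintegral_mono fun ω => squash_strictMono.monotone (sup_mono C D h ω)
  have I_fin : ∀ C, I C ≠ ⊤ := fun C => by
    refine ne_top_of_le_ne_top (measure_ne_top μ univ) ?_
    calc I C ≤ ∫⁻ _, 1 ∂μ := lintegral_mono fun ω => squash_le_one _
      _ = μ univ := by simp
  have hmeas : ∀ C : Set (Ω → EReal), C ⊆ S → C.Countable → Measurable (sup C) :=
    fun C hC hc => Measurable.biSup C hc (fun Y hY => hS Y (hC hY))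
  let 𝒞 : Set (Set (Ω → EReal)) := {C | C ⊆ S ∧ C.Countable}
  have hne : (I '' 𝒞).Nonempty := ⟨I ∅, ∅, ⟨empty_subset _, countable_empty⟩, rfl⟩
  obtain ⟨u, -, hu, hu'⟩ := exists_seq_tendsto_sSup hne (OrderTop.bddAbove _)
  choose C hC hCu using hu'
  let D : Set (Ω → EReal) := ⋃ n, C n
  have hDS : D ⊆ S := iUnion_subset fun n => (hC n).1
  have hDc : D.Countable := countable_iUnion fun n => (hC n).2
  have hDtop : sSup (I '' 𝒞) ≤ I D :=
    le_of_tendsto' hu fun n => by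
      rw [← hCu n]; exact I_mono _ _ (subset_iUnion C n)
  refine ⟨sup D, hmeas D hDS hDc, fun Y hY => ?_, fun W _ hWY => ?_⟩
  · have hYS : insert Y D ⊆ S := insert_subset hY hDS
    have hYc : (insert Y D).Countable := hDc.insert Y
    have hle : I (insert Y D) ≤ I D :=
      (le_sSup (mem_image_of_mem I (show insert Y D ∈ 𝒞 from ⟨hYS, hYc⟩))).trans hDtop
    have hae : (fun ω => squash (sup D ω)) =ᵐ[μ] fun ω => squash (sup (insert Y D) ω) :=
      ae_eq_of_ae_le_of_lintegral_le
        (Eventually.of_forall fun ω =>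
          squash_strictMono.monotone (sup_mono _ _ (subset_insert Y D) ω))
        (I_fin D)
        (squash_strictMono.monotone.measurable.comp (hmeas _ hYS hYc)).aemeasurable hle
    filter_upwards [hae] with ω hω
    rw [squash_strictMono.injective hω]
    exact le_biSup (fun Z : Ω → EReal => Z ω) (mem_insert Y D)
  · have hall : ∀ᵐ ω ∂μ, ∀ Y ∈ D, Y ω ≤ W ω := (ae_ball_iff hDc).2 fun Y hY => hWY Y (hDS hY)
    filter_upwards [hall] with ω hω
    exact iSup₂_le hω

open Classical in
/-- The essential supremum (a version of it) of a family of extended real random variables. -/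
def essSupFamily (μ : Measure Ω) (S : Set (Ω → EReal)) : Ω → EReal :=
  if h : ∃ V, IsEssSup μ S V then h.choose else fun _ => 0

theorem isEssSup_essSupFamily (μ : Measure Ω) [IsFiniteMeasure μ] (S : Set (Ω → EReal))
    (hS : ∀ Y ∈ S, Measurable Y) : IsEssSup μ S (essSupFamily μ S) := by
  have h := exists_isEssSup μ S hS
  unfold essSupFamily
  rw [dif_pos h]
  exact h.choose_spec

end EssentialSupremum

section RightDerivative

/-- The right derivative `f'₊(0)`, the limit of `(f x - f 0) / x` as `x ↓ 0` in the extended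
reals. For a convex `f` on `[0, ∞)` it exists and lies in `[-∞, ∞)`. -/
def rightDerivZero (f : ℝ → ℝ) : EReal :=
  limUnder (𝓝[>] (0 : ℝ)) fun x : ℝ => (((f x - f 0) / x : ℝ) : EReal)

theorem tendsto_rightDerivZero {f : ℝ → ℝ} (hf : ConvexOn ℝ (Ici 0) f) :
    Tendsto (fun x : ℝ => (((f x - f 0) / x : ℝ) : EReal)) (𝓝[>] (0 : ℝ))
      (𝓝 (rightDerivZero f)) := by
  have hmono : MonotoneOn (fun x : ℝ => (((f x - f 0) / x : ℝ) : EReal)) (Ioi 0) := by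
    intro x hx y hy hxy
    have h := hf.secant_mono (a := 0) (x := x) (y := y) self_mem_Ici
      (Ioi_subset_Ici_self hx) (Ioi_subset_Ici_self hy) (ne_of_gt hx) (ne_of_gt hy) hxy
    simp only [sub_zero] at h
    exact EReal.coe_le_coe_iff.2 h
  exact tendsto_nhds_limUnder ⟨_, hmono.tendsto_nhdsGT (OrderBot.bddBelow _)⟩

end RightDerivative

section Market

variable {Ω : Type*} {mΩ : MeasurableSpace Ω} {T : ℝ}

/-- The discounted process `B_s⁻¹ X_s`, `s ∈ [0, T]`. -/
def discounted (B : Icc (0 : ℝ) T → ℝ) (X : Icc (0 : ℝ) T → Ω → ℝ) : Icc (0 : ℝ) T → Ω → ℝ :=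
  fun s ω => (B s)⁻¹ * X s ω

/-- The discounted payoff `B_τ⁻¹ f(X_τ)` received when exercising at the random time `τ`. -/
def exercisePayoff (B : Icc (0 : ℝ) T → ℝ) (X : Icc (0 : ℝ) T → Ω → ℝ) (f : ℝ → ℝ)
    (τ : Ω → Icc (0 : ℝ) T) : Ω → ℝ :=
  fun ω => (B (τ ω))⁻¹ * f (X (τ ω) ω)

/-- `τ` is a stopping time of the filtration with values in `[t, T]`. -/
def IsExerciseTime (ℱ : Filtration (Icc (0 : ℝ) T) mΩ) (t : Icc (0 : ℝ) T)
    (τ : Ω → Icc (0 : ℝ) T) : Prop :=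
  IsStoppingTime ℱ (fun ω => (τ ω : WithTop (Icc (0 : ℝ) T))) ∧ ∀ ω, t ≤ τ ω

/-- The discounted value at time `t` of the European option with payoff `f(X_T)`, where `T'` is
the final time: `B_T⁻¹ E_Q[f(X_T) | ℱ_t]`. -/
def europeanValue (Q : Measure Ω) (ℱ : Filtration (Icc (0 : ℝ) T) mΩ) (B : Icc (0 : ℝ) T → ℝ)
    (X : Icc (0 : ℝ) T → Ω → ℝ) (f : ℝ → ℝ) (T' t : Icc (0 : ℝ) T) : Ω → ℝ :=
  fun ω => (B T')⁻¹ * (Q[fun ω' => f (X T' ω') | ℱ t]) ω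

/-- The family of the random variables `E_Q[B_τ⁻¹ f(X_τ) | ℱ_t]`, with `τ` ranging over the
stopping times with values in `[t, T]`. -/
def exerciseValues (Q : Measure Ω) (ℱ : Filtration (Icc (0 : ℝ) T) mΩ) (B : Icc (0 : ℝ) T → ℝ)
    (X : Icc (0 : ℝ) T → Ω → ℝ) (f : ℝ → ℝ) (t : Icc (0 : ℝ) T) : Set (Ω → EReal) :=
  {Y | ∃ τ : Ω → Icc (0 : ℝ) T, IsExerciseTime ℱ t τ ∧
    Y = fun ω => (((Q[exercisePayoff B X f τ | ℱ t]) ω : ℝ) : EReal)}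

/-- The discounted value at time `t` of the American option with payoff `f(X)` and maturity `T`:
the essential supremum of `E_Q[B_τ⁻¹ f(X_τ) | ℱ_t]` over all stopping times `τ ∈ [t, T]`. -/
def americanValue (Q : Measure Ω) (ℱ : Filtration (Icc (0 : ℝ) T) mΩ) (B : Icc (0 : ℝ) T → ℝ)
    (X : Icc (0 : ℝ) T → Ω → ℝ) (f : ℝ → ℝ) (t : Icc (0 : ℝ) T) : Ω → EReal :=
  essSupFamily Q (exerciseValues Q ℱ B X f t)

theorem isEssSup_americanValue (Q : Measure Ω) [IsFiniteMeasure Q]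
    (ℱ : Filtration (Icc (0 : ℝ) T) mΩ) (B : Icc (0 : ℝ) T → ℝ)
    (X : Icc (0 : ℝ) T → Ω → ℝ) (f : ℝ → ℝ) (t : Icc (0 : ℝ) T) :
    IsEssSup Q (exerciseValues Q ℱ B X f t) (americanValue Q ℱ B X f t) := by
  refine isEssSup_essSupFamily Q _ ?_
  rintro Y ⟨τ, -, rfl⟩
  exact measurable_coe_real_ereal.comp (stronglyMeasurable_condExp.mono (ℱ.le t)).measurable

end Market

end AmericanOption

end

namespace AmericanOption

/-! ### Convex functions on the half-line. -/

section Convex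

/-! Fix a real `k ≤ 0` with `k ≤ f'₊(0)` and set `g x = f x - f 0 - k x`. This `g` is convex,
vanishes at `0` and is nonnegative, hence nondecreasing. Write `X̄` for the discounted process and
`e` for the final time. Since `b⁻¹ g(b x)` increases with `b` (`inv_mul_comp_mul_le`), optional
sampling (`exists_sigmaAlgebra_stopped`) and Jensen (`convexOn_Ici_map_condExp_le`) give `B_τ⁻¹
g(X_τ) ≤ B_e⁻¹ g(B_e X̄_τ) ≤ B_e⁻¹ g(B_e E[X̄_e | G]) ≤ B_e⁻¹ E[g(X_e) | G]`. Condition on `ℱ t` and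
add back the affine part: `f 0` costs at most `f(0)₊ (B_t⁻¹ - B_e⁻¹)`, and `k E[X̄_τ | ℱ t] ≤ k
X̄_t` because `k ≤ 0`. This is `condExp_exercisePayoff_le`, applied with `k = min 0 f'₊(0)` when
that is finite.

If `f'₊(0) = -∞`, the bound is `+∞` wherever `X̄_t < E[X̄_e | ℱ t]`. On the remaining event,
equality propagates to `X̄_τ = E[X̄_e | G]` (`ae_eq_condExp_on_of_condExp_eq`), so the middle step
is trivial and `k = 0` works without monotonicity. -/

theorem exists_affine_le {g : ℝ → ℝ} (hg : ConvexOn ℝ (Ici 0) g) :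
    ∃ a b : ℝ, 0 ≤ b ∧ ∀ x, 0 ≤ x → a - b * x ≤ g x := by
  -- Secants through `1` have slope at most `g 2 - g 1` to the left of `1` and at least `g 1 - g 0`
  -- to the right; the constant covers both.
  refine ⟨g 1 - (|g 1 - g 0| + |g 2 - g 1|), |g 1 - g 0| + |g 2 - g 1|, by positivity,
    fun x hx => ?_⟩
  have h1 := neg_abs_le (g 1 - g 0)
  have h2 := le_abs_self (g 2 - g 1)
  have h3 := abs_nonneg (g 1 - g 0)
  have h4 := abs_nonneg (g 2 - g 1)
  have hm : ∀ y : ℝ, 0 ≤ y → y ∈ Ici (0 : ℝ) := fun _ h => h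
  rcases lt_trichotomy x 1 with hx1 | rfl | hx1
  · have h := hg.secant_mono (a := 1) (x := x) (y := 2) (hm _ zero_le_one) hx (hm _ zero_le_two)
      hx1.ne (by norm_num) (by linarith)
    rw [div_le_iff_of_neg (by linarith)] at h
    norm_num at h
    nlinarith
  · nlinarith
  · have h := hg.secant_mono (a := 1) (x := 0) (y := x) (hm _ zero_le_one) self_mem_Ici hx
      (by norm_num) hx1.ne' (by linarith)
    rw [le_div_iff₀ (by linarith)] at h
    norm_num at h
    nlinarith

/-- Convexity gives continuity only on the open half-line, so the point `0` is split off. -/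
theorem measurable_indicator_of_convexOn {g : ℝ → ℝ} (hg : ConvexOn ℝ (Ici 0) g) :
    Measurable ((Ici 0).indicator g) := by
  have hc : ContinuousOn g (Ioi 0) := by simpa using hg.continuousOn_interior
  have h : (Ici (0 : ℝ)).indicator g =
      (Ioi (0 : ℝ)).indicator g + ({0} : Set ℝ).indicator (fun _ => g 0) := by
    ext x
    rcases lt_trichotomy x 0 with hx | rfl | hx
    · simp [indicator, hx.not_gt, hx.not_ge, hx.ne]
    · simp
    · simp [indicator, hx, hx.le, hx.ne']
  rw [h]
  refine Measurable.add ?_ (measurable_const.indicator (measurableSet_singleton 0))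
  classical
  rw [← piecewise_eq_indicator]
  exact hc.measurable_piecewise continuousOn_const measurableSet_Ioi

/-- The perspective `c ↦ c * g (x / c)` of a convex function vanishing at `0` is antitone. -/
theorem inv_mul_comp_mul_le {g : ℝ → ℝ} (hg : ConvexOn ℝ (Ici 0) g) (hg0 : g 0 = 0)
    {b c x : ℝ} (hb : 0 < b) (hbc : b ≤ c) (hx : 0 ≤ x) :
    b⁻¹ * g (b * x) ≤ c⁻¹ * g (c * x) := by
  have hc : 0 < c := hb.trans_le hbc
  -- `b x` is the convex combination of `c x` and `0` with weight `b / c`.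
  have h := hg.2 (show c * x ∈ Ici 0 from mul_nonneg hc.le hx) self_mem_Ici
    (show 0 ≤ b / c by positivity) (sub_nonneg.2 ((div_le_one hc).2 hbc)) (add_sub_cancel _ _)
  simp only [smul_eq_mul, mul_zero, add_zero, hg0] at h
  have e : b / c * (c * x) = b * x := by field_simp
  rw [e] at h
  calc b⁻¹ * g (b * x) ≤ b⁻¹ * (b / c * g (c * x)) := by gcongr
    _ = c⁻¹ * g (c * x) := by field_simp

/-- The chord slope `g x / x` is nondecreasing, and its sign lets it be multiplied by the growing
`x`. -/
theorem monotoneOn_of_convexOn_of_nonneg {g : ℝ → ℝ} (hg : ConvexOn ℝ (Ici 0) g) (hg0 : g 0 = 0)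
    (hpos : ∀ x, 0 ≤ x → 0 ≤ g x) : MonotoneOn g (Ici 0) := by
  intro x hx y hy hxy
  rcases (mem_Ici.1 hx).eq_or_lt with rfl | hx0
  · rw [hg0]; exact hpos y hy
  have h := inv_mul_comp_mul_le hg hg0 hx0 hxy zero_le_one
  simp only [mul_one] at h
  have hy0 : 0 < y := hx0.trans_le hxy
  calc g x = x * (x⁻¹ * g x) := by field_simp
    _ ≤ x * (y⁻¹ * g y) := by gcongr
    _ = x / y * g y := by ring
    _ ≤ 1 * g y := by
        gcongr
        · exact hpos y hy
        · exact (div_le_one hy0).2 hxy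
    _ = g y := one_mul _

end Convex

/-! ### Conditional expectations and Jensen's inequality. -/

section ConditionalExpectation

variable {Ω : Type*} {m mΩ : MeasurableSpace Ω} {Q : Measure Ω}

theorem aestronglyMeasurable_convexOn_comp {g : ℝ → ℝ} (hg : ConvexOn ℝ (Ici 0) g) {Z : Ω → ℝ}
    (hZ0 : ∀ ω, 0 ≤ Z ω) (hZ : AEMeasurable Z Q) : AEStronglyMeasurable (fun ω => g (Z ω)) Q := by
  have h := ((measurable_indicator_of_convexOn hg).comp_aemeasurable hZ).aestronglyMeasurable
  refine h.congr (Eventually.of_forall fun ω => ?_)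
  simp [indicator, hZ0 ω]

theorem integrable_of_le_of_le {Y Z W : Ω → ℝ} (hY : AEStronglyMeasurable Y Q)
    (hZ : Integrable Z Q) (hW : Integrable W Q) (h1 : Z ≤ᵐ[Q] Y) (h2 : Y ≤ᵐ[Q] W) :
    Integrable Y Q := by
  refine (hZ.norm.add hW.norm).mono' hY ?_
  filter_upwards [h1, h2] with ω a b
  simp only [Real.norm_eq_abs, Pi.add_apply]
  exact abs_le.2 ⟨by linarith [neg_abs_le (Z ω), abs_nonneg (W ω)],
    by linarith [le_abs_self (W ω), abs_nonneg (Z ω)]⟩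

theorem condExp_mono_on (hm : m ≤ mΩ) {Y Z : Ω → ℝ} {A : Set Ω} (hA : MeasurableSet[m] A)
    (hY : Integrable Y Q) (hZ : Integrable Z Q) (h : ∀ᵐ ω ∂Q, ω ∈ A → Y ω ≤ Z ω) :
    ∀ᵐ ω ∂Q, ω ∈ A → (Q[Y | m]) ω ≤ (Q[Z | m]) ω := by
  have h1 : A.indicator Y ≤ᵐ[Q] A.indicator Z := by
    filter_upwards [h] with ω hω
    by_cases hωA : ω ∈ A <;> simp [hωA, hω]
  filter_upwards [condExp_mono (m := m) (hY.indicator (hm _ hA)) (hZ.indicator (hm _ hA)) h1,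
    condExp_indicator hY hA, condExp_indicator hZ hA] with ω h2 h3 h4 hωA
  rw [h3, h4] at h2
  simpa [hωA] using h2

variable [IsProbabilityMeasure Q]

theorem condExp_le_condExp_of_setIntegral_le (hm : m ≤ mΩ) {Y Z : Ω → ℝ}
    (hY : Integrable Y Q) (hZ : Integrable Z Q)
    (h : ∀ A, MeasurableSet[m] A → ∫ ω in A, Y ω ∂Q ≤ ∫ ω in A, Z ω ∂Q) :
    Q[Y | m] ≤ᵐ[Q] Q[Z | m] := by
  have hYm := stronglyMeasurable_condExp (f := Y) (m := m) (μ := Q)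
  have hZm := stronglyMeasurable_condExp (f := Z) (m := m) (μ := Q)
  refine ae_le_of_ae_le_trim (hm := hm) (ae_le_of_forall_setIntegral_le
    (integrable_condExp.trim hm hYm) (integrable_condExp.trim hm hZm) fun A hA _ => ?_)
  rw [← setIntegral_trim hm hYm hA, ← setIntegral_trim hm hZm hA, setIntegral_condExp hm hY hA,
    setIntegral_condExp hm hZ hA]
  exact h A hA

/-- Conditional Jensen inequality for a convex function on `[0, ∞)`, which need not be lower
semicontinuous at `0`. -/
theorem convexOn_Ici_map_condExp_le (hm : m ≤ mΩ) {g : ℝ → ℝ} (hg : ConvexOn ℝ (Ici 0) g)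
    {Z : Ω → ℝ} (hZ0 : ∀ ω, 0 ≤ Z ω) (hZ : Integrable Z Q) (hgZ : Integrable (fun ω => g (Z ω)) Q) :
    ∀ᵐ ω ∂Q, g ((Q[Z | m]) ω) ≤ (Q[fun ω' => g (Z ω') | m]) ω := by
  have hc : ContinuousOn g (Ioi 0) := by simpa using hg.continuousOn_interior
  have hpos : 0 ≤ᵐ[Q] Q[Z | m] := condExp_nonneg (Eventually.of_forall hZ0)
  -- Where its conditional expectation is `0`, the nonnegative `Z` vanishes almost surely.
  have hzero : ∀ᵐ ω ∂Q, (Q[Z | m]) ω = 0 → g 0 ≤ (Q[fun ω' => g (Z ω') | m]) ω := by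
    let A := {ω | (Q[Z | m]) ω = 0}
    have hA : MeasurableSet[m] A := stronglyMeasurable_condExp.measurable (measurableSet_singleton 0)
    have hint : ∫ ω in A, Z ω ∂Q = 0 := by
      rw [← setIntegral_condExp hm hZ hA]
      exact setIntegral_eq_zero_of_forall_eq_zero fun ω hω => hω
    rw [setIntegral_eq_zero_iff_of_nonneg_ae (Eventually.of_forall hZ0) hZ.integrableOn] at hint
    have hint' := (ae_restrict_iff' (hm _ hA)).1 hint
    filter_upwards [condExp_mono_on hm hA (integrable_const (g 0)) hgZ (by
      filter_upwards [hint'] with ω hω hωA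
      have : Z ω = 0 := hω hωA
      rw [this])] with ω hω hωA
    simpa [condExp_const hm] using hω hωA
  obtain ⟨a, b, hb, hab⟩ := exists_affine_le hg
  -- Precomposing with `x ↦ (1 - ε) x + ε` stays inside the open half-line, where `g` is continuous,
  -- so the lower semicontinuous Jensen inequality applies. Convexity bounds the result, and `ε → 0`
  -- recovers the claim where the conditional expectation is positive.
  have key : ∀ n : ℕ, ∀ᵐ ω ∂Q,
      g ((1 - 1 / ((n : ℝ) + 1)) * (Q[Z | m]) ω + 1 / ((n : ℝ) + 1)) ≤
        (1 - 1 / ((n : ℝ) + 1)) * (Q[fun ω' => g (Z ω') | m]) ω + 1 / ((n : ℝ) + 1) * g 1 := by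
    intro n
    set ε : ℝ := 1 / ((n : ℝ) + 1) with hε
    have hε0 : 0 < ε := by positivity
    have hε1 : ε ≤ 1 := by
      rw [hε, div_le_one (by positivity)]
      have : (0 : ℝ) ≤ n := n.cast_nonneg
      linarith
    have hmem : ∀ x ∈ Ici (0 : ℝ), 0 < (1 - ε) * x + ε := fun x hx =>
      add_pos_of_nonneg_of_pos (mul_nonneg (by linarith) hx) hε0
    let φ : ℝ → ℝ := fun x => g ((1 - ε) * x + ε)
    have hφ : ConvexOn ℝ (Ici 0) φ := by
      refine ⟨convex_Ici 0, fun x hx y hy s t hs ht hst => ?_⟩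
      have h := hg.2 (hmem x hx).le (hmem y hy).le hs ht hst
      simp only [smul_eq_mul] at h ⊢
      convert h using 2
      linear_combination (-ε) * hst
    have hφc : ContinuousOn φ (Ici 0) := hc.comp (by fun_prop) hmem
    have hφle : ∀ x, 0 ≤ x → φ x ≤ (1 - ε) * g x + ε * g 1 := fun x hx => by
      have h := hg.2 (show x ∈ Ici 0 from hx)
        (show (1 : ℝ) ∈ Ici 0 from zero_le_one (α := ℝ))
        (sub_nonneg.2 hε1) hε0.le (sub_add_cancel _ _)
      simpa [φ] using h
    have hup : Integrable (fun ω => (1 - ε) * g (Z ω) + ε * g 1) Q :=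
      (hgZ.const_mul _).add (integrable_const _)
    have hφZ : Integrable (φ ∘ Z) Q := by
      refine integrable_of_le_of_le (Z := fun ω => a - b * ((1 - ε) * Z ω + ε))
        (aestronglyMeasurable_convexOn_comp hφ hZ0 hZ.aemeasurable) ?_ hup
        (Eventually.of_forall fun ω => hab _ (hmem _ (hZ0 ω)).le)
        (Eventually.of_forall fun ω => hφle _ (hZ0 ω))
      exact (integrable_const a).sub (((hZ.const_mul _).add (integrable_const _)).const_mul b)
    have hJ := hφ.map_condExp_le hm hφc.lowerSemicontinuousOn (Eventually.of_forall hZ0)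
      isClosed_Ici hZ hφZ
    have hM := condExp_mono (m := m) hφZ hup (Eventually.of_forall fun ω => hφle _ (hZ0 ω))
    filter_upwards [hJ, hM, condExp_add (hgZ.const_mul (1 - ε)) (integrable_const (ε * g 1)) m,
      condExp_smul (μ := Q) (1 - ε) (fun ω => g (Z ω)) m] with ω h1 h2 h3 h4
    refine (h1.trans h2).trans (le_of_eq ?_)
    have h4' : (Q[fun ω' => (1 - ε) * g (Z ω') | m]) ω = (1 - ε) * (Q[fun ω' => g (Z ω') | m]) ω := h4
    refine h3.trans ?_
    rw [Pi.add_apply, h4', condExp_const hm]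
  filter_upwards [ae_all_iff.2 key, hpos, hzero] with ω h1 h2 h3
  rcases (show (0 : ℝ) ≤ (Q[Z | m]) ω from h2).eq_or_lt with h0 | h0
  · rw [← h0]; exact h3 h0.symm
  · have hε := tendsto_one_div_add_atTop_nhds_zero_nat (𝕜 := ℝ)
    have hε' := tendsto_const_nhds (x := (1 : ℝ)).sub hε
    rw [sub_zero] at hε'
    have t1 := (hε'.mul_const ((Q[Z | m]) ω)).add hε
    have t2 := (hε'.mul_const ((Q[fun ω' => g (Z ω') | m]) ω)).add (hε.mul_const (g 1))
    rw [one_mul, add_zero] at t1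
    rw [one_mul, zero_mul, add_zero] at t2
    exact le_of_tendsto_of_tendsto' ((hc.continuousAt (Ioi_mem_nhds h0)).tendsto.comp t1) t2 h1

end ConditionalExpectation

/-! ### Submartingales at stopping times with finitely many values. -/

section FiniteRange

variable {Ω ι : Type*} {mΩ : MeasurableSpace Ω} [LinearOrder ι] {Q : Measure Ω}
  {ℱ : Filtration ι mΩ} {Y : ι → Ω → ℝ} {σ : Ω → ι}

theorem measurableSet_eq_of_finite_range
    (hσ : IsStoppingTime ℱ (fun ω => (σ ω : WithTop ι))) (hfin : (range σ).Finite) (i : ι) :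
    MeasurableSet[ℱ i] {ω | σ ω = i} := by
  have h : (range (fun ω => (σ ω : WithTop ι))).Countable := by
    rw [range_comp' (fun i : ι => (i : WithTop ι)) σ]
    exact (hfin.image _).countable
  simpa using hσ.measurableSet_eq_of_countable_range h i

theorem stronglyMeasurable_stopped (hY : StronglyAdapted ℱ Y)
    (hσ : IsStoppingTime ℱ (fun ω => (σ ω : WithTop ι))) (hfin : (range σ).Finite) :
    StronglyMeasurable[hσ.measurableSpace] (fun ω => Y (σ ω) ω) := by
  refine Measurable.stronglyMeasurable fun U hU => ?_
  have h : (fun ω => Y (σ ω) ω) ⁻¹' U = ⋃ i ∈ range σ, (Y i ⁻¹' U ∩ {ω | (σ ω : WithTop ι) = i}) := by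
    ext ω
    simp only [mem_preimage, mem_iUnion, mem_inter_iff, mem_ofPred_eq, WithTop.coe_inj, exists_prop]
    exact ⟨fun h => ⟨σ ω, mem_range_self ω, h, rfl⟩, fun ⟨i, _, h, hi⟩ => hi ▸ h⟩
  rw [h]
  refine MeasurableSet.biUnion hfin.countable fun i _ => ?_
  rw [hσ.measurableSet_inter_eq_iff]
  refine ((hY i).measurable hU).inter ?_
  simpa using measurableSet_eq_of_finite_range hσ hfin i

theorem integrable_stopped (hY : Submartingale Y ℱ Q)
    (hσ : IsStoppingTime ℱ (fun ω => (σ ω : WithTop ι))) (hfin : (range σ).Finite) :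
    Integrable (fun ω => Y (σ ω) ω) Q := by
  have h : (fun ω => Y (σ ω) ω) =
      fun ω => ∑ i ∈ hfin.toFinset, {ω | σ ω = i}.indicator (Y i) ω := by
    ext ω
    rw [Finset.sum_eq_single (σ ω)]
    · simp
    · intro i _ hi
      simp [hi.symm]
    · simp
  rw [h]
  exact integrable_finsetSum _ fun i _ =>
    (hY.integrable i).indicator (ℱ.le i _ (measurableSet_eq_of_finite_range hσ hfin i))

variable [IsProbabilityMeasure Q]

/-- On `{σ = i}`, conditioning on the past of `σ` is conditioning on `ℱ i`. -/
theorem stopped_le_condExp (hY : Submartingale Y ℱ Q)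
    (hσ : IsStoppingTime ℱ (fun ω => (σ ω : WithTop ι))) (hfin : (range σ).Finite) {j : ι}
    (hj : ∀ ω, σ ω ≤ j) : (fun ω => Y (σ ω) ω) ≤ᵐ[Q] Q[Y j | hσ.measurableSpace] := by
  have hc : (range (fun ω => (σ ω : WithTop ι))).Countable := by
    rw [range_comp' (fun i : ι => (i : WithTop ι)) σ]
    exact (hfin.image _).countable
  have h : ∀ i ∈ range σ, ∀ᵐ ω ∂Q, σ ω = i → Y (σ ω) ω ≤ (Q[Y j | hσ.measurableSpace]) ω := by
    rintro _ ⟨ω₀, rfl⟩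
    have h1 := condExp_stopping_time_ae_eq_restrict_eq_of_countable_range (μ := Q) (f := Y j)
      hσ hc (σ ω₀)
    have hm : MeasurableSet {x | (σ x : WithTop ι) = σ ω₀} := by
      simpa using ℱ.le _ _ (measurableSet_eq_of_finite_range hσ hfin (σ ω₀))
    have h1' := (ae_restrict_iff' hm).1 h1
    filter_upwards [h1', hY.ae_le_condExp (hj ω₀)] with ω h2 h3 h4
    rw [h2 (by simp [h4]), h4]
    exact h3
  filter_upwards [(ae_ball_iff hfin.countable).2 h] with ω hω
  exact hω _ (mem_range_self ω) rfl

/-- Induction on the largest allowed value `v`: with `w` the next largest, `σ` and `min σ w` differ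
only on `{σ > w}`, an event of `ℱ w` on which they equal `v` and `w`. -/
theorem setIntegral_le_setIntegral_stopped (hY : Submartingale Y ℱ Q) {t : ι} {A : Set Ω}
    (hA : MeasurableSet[ℱ t] A) (s : Finset ι) (hs : ∀ i ∈ s, t < i) :
    ∀ σ : Ω → ι, IsStoppingTime ℱ (fun ω => (σ ω : WithTop ι)) →
      (∀ ω, σ ω ∈ insert t s) → ∫ ω in A, Y t ω ∂Q ≤ ∫ ω in A, Y (σ ω) ω ∂Q := by
  classical
  induction s using Finset.induction_on_max with
  | empty =>
    intro σ _ hσs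
    have : ∀ ω, σ ω = t := by simpa using hσs
    simp [this]
  | insert v s hv ih =>
    intro σ hσ hσs
    have hfin : ∀ ρ : Ω → ι, ∀ u : Finset ι, (∀ ω, ρ ω ∈ u) → (range ρ).Finite := fun ρ u h =>
      u.finite_toSet.subset (range_subset_iff.2 h)
    have hne : (insert t s).Nonempty := Finset.insert_nonempty t s
    set w := (insert t s).max' hne with hw
    have hwm : w ∈ insert t s := Finset.max'_mem _ _
    have htw : t ≤ w := Finset.le_max' _ _ (Finset.mem_insert_self t s)
    have hwv : w < v := by
      rcases Finset.mem_insert.1 hwm with h | h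
      · rw [h]; exact hs v (Finset.mem_insert_self v s)
      · exact hv w h
    have hcase : ∀ ω, σ ω = v ∨ (σ ω ∈ insert t s ∧ σ ω ≤ w) := fun ω => by
      have h := hσs ω
      rw [Finset.insert_comm, Finset.mem_insert] at h
      rcases h with h | h
      · exact Or.inl h
      · exact Or.inr ⟨h, Finset.le_max' _ _ h⟩
    have hσ' : IsStoppingTime ℱ (fun ω => ((min (σ ω) w : ι) : WithTop ι)) := by
      simpa using hσ.min_const w
    have hσ's : ∀ ω, min (σ ω) w ∈ insert t s := fun ω => by
      rcases hcase ω with h | h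
      · rw [h, min_eq_right hwv.le]; exact hwm
      · rw [min_eq_left h.2]; exact h.1
    refine (ih (fun i hi => hs i (Finset.mem_insert_of_mem hi)) _ hσ' hσ's).trans ?_
    have hC : MeasurableSet[ℱ w] {ω | σ ω ≤ w} := by simpa using hσ w
    have hC' := ℱ.le w _ hC
    have hAw := ℱ.mono htw _ hA
    have i1 := integrable_stopped hY hσ' (hfin _ _ hσ's)
    have i2 := integrable_stopped hY hσ (hfin _ _ hσs)
    rw [← integral_inter_add_sdiff hC' i1.integrableOn,
      ← integral_inter_add_sdiff hC' i2.integrableOn]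
    have e1 : ∫ ω in A ∩ {ω | σ ω ≤ w}, Y (min (σ ω) w) ω ∂Q =
        ∫ ω in A ∩ {ω | σ ω ≤ w}, Y (σ ω) ω ∂Q :=
      setIntegral_congr_fun ((ℱ.le _ _ hA).inter hC') fun ω hω => by
        simp only [min_eq_left (show σ ω ≤ w from hω.2)]
    have hd := (ℱ.le _ _ hA).diff hC'
    have e2 : ∫ ω in A \ {ω | σ ω ≤ w}, Y (min (σ ω) w) ω ∂Q =
        ∫ ω in A \ {ω | σ ω ≤ w}, Y w ω ∂Q :=
      setIntegral_congr_fun hd fun ω hω => by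
        simp only [min_eq_right (not_le.1 (show ¬ σ ω ≤ w from hω.2)).le]
    have e3 : ∫ ω in A \ {ω | σ ω ≤ w}, Y (σ ω) ω ∂Q =
        ∫ ω in A \ {ω | σ ω ≤ w}, Y v ω ∂Q :=
      setIntegral_congr_fun hd fun ω hω => by
        simp only [(hcase ω).resolve_right fun h => hω.2 h.2]
    rw [e1, e2, e3]
    exact add_le_add le_rfl (hY.setIntegral_le hwv.le (hAw.diff hC))

end FiniteRange

/-! ### Dyadic approximation of times from above. -/

section Discretization

/-- Round up to a multiple of `2⁻ⁿ` and truncate at `T`. The last clause makes `φ n ∘ τ` a stopping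
time: `{φ n τ ≤ u} = {τ ≤ v}` with `v ≤ u`. -/
theorem exists_discretization {T : ℝ} (hT : 0 ≤ T) :
    ∃ φ : ℕ → Icc (0 : ℝ) T → Icc (0 : ℝ) T, (∀ n s, s ≤ φ n s) ∧
      (∀ s, Antitone fun n => φ n s) ∧ (∀ s, Tendsto (fun n => φ n s) atTop (𝓝 s)) ∧
      (∀ n, (range (φ n)).Finite) ∧
      ∀ n u, ∃ v ≤ u, ∀ s, φ n s ≤ u ↔ s ≤ v := by
  have hp : ∀ n : ℕ, (0 : ℝ) < 2 ^ n := fun n => by positivity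
  let ψ : ℕ → ℕ → Icc (0 : ℝ) T := fun n k =>
    ⟨min ((k : ℝ) / 2 ^ n) T, le_min (by positivity) hT, min_le_right _ _⟩
  let φ : ℕ → Icc (0 : ℝ) T → Icc (0 : ℝ) T := fun n s => ψ n ⌈(s : ℝ) * 2 ^ n⌉₊
  have hle : ∀ n s, s ≤ φ n s := fun n s =>
    le_min ((le_div_iff₀ (hp n)).2 (Nat.le_ceil _)) s.2.2
  refine ⟨φ, hle, fun s => antitone_nat_of_succ_le fun n => ?_, fun s => ?_, fun n => ?_,
    fun n u => ?_⟩
  · refine min_le_min_right T ?_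
    rw [div_le_div_iff₀ (hp _) (hp _), pow_succ]
    have h : ⌈(s : ℝ) * (2 ^ n * 2)⌉₊ ≤ ⌈(s : ℝ) * 2 ^ n⌉₊ * 2 := by
      rw [Nat.ceil_le]
      push_cast
      have := Nat.le_ceil ((s : ℝ) * 2 ^ n)
      linarith
    have h' : ((⌈(s : ℝ) * (2 ^ n * 2)⌉₊ : ℕ) : ℝ) ≤ ⌈(s : ℝ) * 2 ^ n⌉₊ * 2 := by exact_mod_cast h
    nlinarith [hp n]
  · rw [tendsto_subtype_rng]
    have hup : ∀ n, ((φ n s : Icc (0 : ℝ) T) : ℝ) ≤ s + (1 / 2) ^ n := fun n => by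
      refine (min_le_left _ _).trans ?_
      rw [div_le_iff₀ (hp n), add_mul, ← mul_pow]
      have := Nat.ceil_lt_add_one (mul_nonneg s.2.1 (hp n).le)
      norm_num
      exact this.le
    have hlim : Tendsto (fun n : ℕ => (s : ℝ) + (1 / 2) ^ n) atTop (𝓝 s) := by
      simpa using (tendsto_const_nhds (x := (s : ℝ))).add
        (tendsto_pow_atTop_nhds_zero_of_lt_one (by norm_num : (0 : ℝ) ≤ 1 / 2) (by norm_num))
    exact tendsto_of_tendsto_of_tendsto_of_le_of_le tendsto_const_nhds hlim (fun n => hle n s) hup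
  · refine ((Finset.range (⌈T * 2 ^ n⌉₊ + 1)).finite_toSet.image (ψ n)).subset ?_
    rintro _ ⟨s, rfl⟩
    refine mem_image_of_mem _ ?_
    rw [Finset.coe_range, mem_Iio, Nat.lt_succ_iff]
    exact Nat.ceil_mono (mul_le_mul_of_nonneg_right s.2.2 (hp n).le)
  -- For `u = T` truncation makes the inequality automatic, so `v = T`; otherwise `v` is `u` rounded
  -- down to the grid.
  · rcases u.2.2.eq_or_lt with hu | hu
    · exact ⟨u, le_rfl, fun s => by
        simp only [← Subtype.coe_le_coe, hu]
        exact iff_of_true (φ n s).2.2 s.2.2⟩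
    · have hfl : (⌊(u : ℝ) * 2 ^ n⌋₊ : ℝ) / 2 ^ n ≤ u := by
        rw [div_le_iff₀ (hp n)]
        exact Nat.floor_le (mul_nonneg u.2.1 (hp n).le)
      refine ⟨⟨(⌊(u : ℝ) * 2 ^ n⌋₊ : ℝ) / 2 ^ n, by positivity, hfl.trans u.2.2⟩, hfl, fun s => ?_⟩
      simp only [← Subtype.coe_le_coe]
      rw [show ((φ n s : Icc (0 : ℝ) T) : ℝ) = min ((⌈(s : ℝ) * 2 ^ n⌉₊ : ℝ) / 2 ^ n) T from rfl,
        min_le_iff, or_iff_left hu.not_ge, div_le_iff₀ (hp n), le_div_iff₀ (hp n),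
        ← Nat.le_floor_iff (mul_nonneg u.2.1 (hp n).le), ← Nat.ceil_le]

end Discretization

/-! ### Optional sampling in continuous time. -/

section OptionalSampling

variable {Ω : Type*} {mΩ : MeasurableSpace Ω} {Q : Measure Ω}

theorem unifIntegrable_of_nonneg_of_le {Y Z : ℕ → Ω → ℝ} (hZ : UnifIntegrable Z 1 Q)
    (h0 : ∀ n ω, 0 ≤ Y n ω) (h : ∀ n, Y n ≤ᵐ[Q] Z n) : UnifIntegrable Y 1 Q := by
  intro ε hε
  obtain ⟨δ, hδ, H⟩ := hZ hε
  refine ⟨δ, hδ, fun n s hs hμs => (eLpNorm_mono_ae ?_).trans (H n s hs hμs)⟩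
  filter_upwards [h n] with ω hω
  by_cases hωs : ω ∈ s
  · simp only [hωs, indicator_of_mem, Real.norm_eq_abs]
    exact abs_le_abs_of_nonneg (h0 n ω) hω
  · simp [hωs]

variable [IsProbabilityMeasure Q]

/-- Optional sampling for a nonnegative submartingale whose paths are almost surely
right-continuous, at a stopping time `τ ≥ t`. As the filtration need not be right-continuous, the
σ-algebra of events before `τ` is replaced by a larger one. -/
theorem exists_sigmaAlgebra_stopped {T : ℝ} (hT : 0 ≤ T) {ℱ : Filtration (Icc (0 : ℝ) T) mΩ}
    {Y : Icc (0 : ℝ) T → Ω → ℝ} (hY : Submartingale Y ℱ Q) (hY0 : ∀ s ω, 0 ≤ Y s ω)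
    (hrc : ∀ᵐ ω ∂Q, ∀ s : Icc (0 : ℝ) T, ContinuousWithinAt (fun u => Y u ω) (Ici s) s)
    {t : Icc (0 : ℝ) T} {τ : Ω → Icc (0 : ℝ) T} (hτ : IsExerciseTime ℱ t τ) :
    ∃ G : MeasurableSpace Ω, ℱ t ≤ G ∧ G ≤ mΩ ∧ Integrable (fun ω => Y (τ ω) ω) Q ∧
      (fun ω => Y (τ ω) ω) ≤ᵐ[Q] Q[Y ⟨T, right_mem_Icc.2 hT⟩ | G] ∧
      Y t ≤ᵐ[Q] Q[fun ω => Y (τ ω) ω | ℱ t] := by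
  obtain ⟨φ, hle, hanti, hlim, hfin, hst⟩ := exists_discretization hT
  set e : Icc (0 : ℝ) T := ⟨T, right_mem_Icc.2 hT⟩
  have hσ : ∀ n, IsStoppingTime ℱ (fun ω => (φ n (τ ω) : WithTop (Icc (0 : ℝ) T))) := by
    intro n u
    obtain ⟨v, hvu, hv⟩ := hst n u
    have h := ℱ.mono hvu _ (hτ.1 v)
    simp only [WithTop.coe_le_coe] at h ⊢
    simpa only [hv] using h
  have hσfin : ∀ n, (range fun ω => φ n (τ ω)).Finite := fun n =>
    (hfin n).subset (range_comp_subset_range τ (φ n))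
  have htσ : ∀ n ω, t ≤ φ n (τ ω) := fun n ω => (hτ.2 ω).trans (hle n _)
  have hconv : ∀ᵐ ω ∂Q, Tendsto (fun n => Y (φ n (τ ω)) ω) atTop (𝓝 (Y (τ ω) ω)) := by
    filter_upwards [hrc] with ω hω
    exact (hω (τ ω)).tendsto.comp
      (tendsto_nhdsWithin_iff.2 ⟨hlim _, Eventually.of_forall fun n => hle n _⟩)
  have hGle : ∀ n, (hσ n).measurableSpace ≤ mΩ := fun n => (hσ n).measurableSpace_le
  have hint : ∀ n, Integrable (fun ω => Y (φ n (τ ω)) ω) Q := fun n =>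
    integrable_stopped hY (hσ n) (hσfin n)
  have hdom : ∀ n, (fun ω => Y (φ n (τ ω)) ω) ≤ᵐ[Q] Q[Y e | (hσ n).measurableSpace] := fun n =>
    stopped_le_condExp hY (hσ n) (hσfin n) fun ω => (φ n (τ ω)).2.2
  -- Conditional expectations of one integrable variable are uniformly integrable; nonnegativity and
  -- domination pass this to the stopped values, so they converge in `L¹`.
  have hUI := (hY.integrable e).uniformIntegrable_condExp hGle
  have hui : UnifIntegrable (fun n ω => Y (φ n (τ ω)) ω) 1 Q :=
    unifIntegrable_of_nonneg_of_le hUI.unifIntegrable (fun n ω => hY0 _ _) hdom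
  obtain ⟨C, hC⟩ := hUI.2.2
  have hUI' : UniformIntegrable (fun n ω => Y (φ n (τ ω)) ω) 1 Q :=
    ⟨fun n => (hint n).aestronglyMeasurable, hui, C, fun n => (eLpNorm_mono_ae (by
      filter_upwards [hdom n] with ω hω
      exact abs_le_abs_of_nonneg (hY0 _ _) hω)).trans (hC n)⟩
  have hτint : Integrable (fun ω => Y (τ ω) ω) Q := hUI'.integrable_of_ae_tendsto hconv
  have hL1 := tendsto_Lp_finite_of_tendsto_ae le_rfl ENNReal.one_ne_top
    (fun n => (hint n).aestronglyMeasurable) (memLp_one_iff_integrable.2 hτint) hui hconv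
  have hset : ∀ A : Set Ω, Tendsto (fun n => ∫ ω in A, Y (φ n (τ ω)) ω ∂Q) atTop
      (𝓝 (∫ ω in A, Y (τ ω) ω ∂Q)) := fun A =>
    tendsto_setIntegral_of_L1' _ hτint.aestronglyMeasurable (Eventually.of_forall hint) hL1 A
  -- Small enough that every discrete inequality can be integrated over its events, large enough to
  -- make the limit measurable up to a null set.
  let G : MeasurableSpace Ω := ⨅ n, (hσ n).measurableSpace
  have hGn : ∀ n, G ≤ (hσ n).measurableSpace := fun n => iInf_le _ n
  have hG : G ≤ mΩ := (hGn 0).trans (hGle 0)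
  have hmono : Antitone fun n => (hσ n).measurableSpace := fun n k hnk =>
    IsStoppingTime.measurableSpace_mono _ _ fun ω => WithTop.coe_le_coe.2 (hanti _ hnk)
  have hmeas : AEStronglyMeasurable[G] (fun ω => Y (τ ω) ω) Q := by
    refine ⟨fun ω => limsup (fun n => Y (φ n (τ ω)) ω) atTop, ?_, ?_⟩
    · refine Measurable.stronglyMeasurable fun U hU => ?_
      refine MeasurableSpace.measurableSet_iInf.2 fun k => ?_
      -- The limsup depends only on the tail from `k` on, whose terms are known at the `k`-th
      -- discretized time.
      have hk : @Measurable _ _ (hσ k).measurableSpace _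
          (fun ω => limsup (fun n => Y (φ (n + k) (τ ω)) ω) atTop) :=
        Measurable.limsup fun n =>
          ((stronglyMeasurable_stopped hY.1 (hσ (n + k)) (hσfin (n + k))).mono
            (hmono (Nat.le_add_left k n))).measurable
      have hEq : (fun ω => limsup (fun n => Y (φ n (τ ω)) ω) atTop) =
          fun ω => limsup (fun n => Y (φ (n + k) (τ ω)) ω) atTop := by
        ext ω
        exact (limsup_nat_add (fun n => Y (φ n (τ ω)) ω) k).symm
      rw [hEq]
      exact hk hU
    · filter_upwards [hconv] with ω hω
      exact hω.limsup_eq.symm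
  refine ⟨G, le_iInf fun n => (hσ n).le_measurableSpace_of_const_le fun ω =>
    WithTop.coe_le_coe.2 (htσ n ω), hG, hτint, ?_, ?_⟩
  · have h1 := condExp_le_condExp_of_setIntegral_le hG hτint (hY.integrable e) fun A hA => by
      refine le_of_tendsto' (hset A) fun n => ?_
      rw [← setIntegral_condExp (hGle n) (hY.integrable e) (hGn n _ hA)]
      exact setIntegral_mono_ae (hint n).integrableOn integrable_condExp.integrableOn (hdom n)
    filter_upwards [h1, condExp_of_aestronglyMeasurable' hG hmeas hτint] with ω h2 h3
    rwa [h3] at h2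
  · have h1 := condExp_le_condExp_of_setIntegral_le (ℱ.le t) (hY.integrable t) hτint fun A hA => by
      refine ge_of_tendsto' (hset A) fun n => ?_
      classical
      refine setIntegral_le_setIntegral_stopped hY hA ((hσfin n).toFinset.filter (t < ·))
        (fun i hi => (Finset.mem_filter.1 hi).2) _ (hσ n) fun ω => ?_
      rcases (htσ n ω).eq_or_lt with h | h
      · rw [← h]; exact Finset.mem_insert_self _ _
      · exact Finset.mem_insert_of_mem (Finset.mem_filter.2 ⟨by simp, h⟩)
    rwa [condExp_of_stronglyMeasurable (ℱ.le t) (hY.1 t) (hY.integrable t)] at h1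

end OptionalSampling

/-! ### Bounds for a single exercise time. -/

section Bounds

theorem condExp_affine {Ω : Type*} {m mΩ : MeasurableSpace Ω} {Q : Measure Ω}
    [IsProbabilityMeasure Q] (hm : m ≤ mΩ) {Y Z : Ω → ℝ} (hY : Integrable Y Q) (hZ : Integrable Z Q)
    (a b c : ℝ) : Q[fun ω => a * Y ω + b * Z ω + c | m] =ᵐ[Q]
      fun ω => a * (Q[Y | m]) ω + b * (Q[Z | m]) ω + c := by
  filter_upwards [condExp_add ((hY.smul a).add (hZ.smul b)) (integrable_const c) m,
    condExp_add (hY.smul a) (hZ.smul b) m, condExp_smul (μ := Q) a Y m,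
    condExp_smul (μ := Q) b Z m] with ω h1 h2 h3 h4
  refine h1.trans ?_
  rw [Pi.add_apply, h2, Pi.add_apply, h3, h4, condExp_const hm]
  rfl

variable {Ω : Type*} {G mΩ : MeasurableSpace Ω} {Q : Measure Ω}
  {T : ℝ} {ℱ : Filtration (Icc (0 : ℝ) T) mΩ} {B : Icc (0 : ℝ) T → ℝ}
  {X : Icc (0 : ℝ) T → Ω → ℝ} {f g : ℝ → ℝ} {t e : Icc (0 : ℝ) T} {τ : Ω → Icc (0 : ℝ) T}

theorem mul_discounted (hB : ∀ s, 0 < B s) (s : Icc (0 : ℝ) T) (ω : Ω) :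
    B s * discounted B X s ω = X s ω :=
  mul_inv_cancel_left₀ (hB s).ne' _

theorem discounted_nonneg (hB : ∀ s, 0 < B s) (hX : ∀ s ω, 0 ≤ X s ω) (s : Icc (0 : ℝ) T) (ω : Ω) :
    0 ≤ discounted B X s ω :=
  mul_nonneg (inv_nonneg.2 (hB s).le) (hX s ω)

theorem IsExerciseTime.measurable (hτ : IsExerciseTime ℱ t τ) : Measurable τ :=
  measurable_of_Iic fun u => by
    have h := ℱ.le u _ (hτ.1 u)
    simp only [WithTop.coe_le_coe] at h
    exact h

theorem aestronglyMeasurable_exercisePayoff (hB : Monotone B) (hBpos : ∀ s, 0 < B s)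
    (hX : ∀ s ω, 0 ≤ X s ω) (hf : ConvexOn ℝ (Ici 0) f) (hτ : Measurable τ)
    (hXτ : AEStronglyMeasurable (fun ω => discounted B X (τ ω) ω) Q) :
    AEStronglyMeasurable (exercisePayoff B X f τ) Q := by
  have hBτ : Measurable fun ω => B (τ ω) := hB.measurable.comp hτ
  have h := aestronglyMeasurable_convexOn_comp hf (Q := Q) (Z := fun ω => X (τ ω) ω)
    (fun ω => hX _ ω) ((hBτ.aemeasurable.mul hXτ.aemeasurable).congr
      (Eventually.of_forall fun ω => mul_discounted hBpos _ _))
  exact hBτ.inv.aestronglyMeasurable.mul h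

theorem comp_mul_le_comp_mul_condExp (hBpos : ∀ s, 0 < B s) (hX : ∀ s ω, 0 ≤ X s ω)
    (hg : MonotoneOn g (Ici 0))
    (hle : (fun ω => discounted B X (τ ω) ω) ≤ᵐ[Q] Q[discounted B X e | G]) :
    ∀ᵐ ω ∂Q, g (B e * discounted B X (τ ω) ω) ≤ g (B e * (Q[discounted B X e | G]) ω) := by
  filter_upwards [hle] with ω h
  have h0 := discounted_nonneg hBpos hX (τ ω) ω
  exact hg (mul_nonneg (hBpos e).le h0) (mul_nonneg (hBpos e).le (h0.trans h))
    (mul_le_mul_of_nonneg_left h (hBpos e).le)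

variable [IsProbabilityMeasure Q]

theorem inv_mul_le_condExp (hB : Monotone B) (hBpos : ∀ s, 0 < B s)
    (hX : ∀ s ω, 0 ≤ X s ω) (he : ∀ s, s ≤ e) (hXe : Integrable (discounted B X e) Q)
    (hG : G ≤ mΩ) (hg : ConvexOn ℝ (Ici 0) g) (hg0 : g 0 = 0)
    (hge : Integrable (fun ω => g (X e ω)) Q) {A : Set Ω}
    (h : ∀ᵐ ω ∂Q, ω ∈ A → g (B e * discounted B X (τ ω) ω) ≤
      g (B e * (Q[discounted B X e | G]) ω)) :
    ∀ᵐ ω ∂Q, ω ∈ A →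
      (B (τ ω))⁻¹ * g (X (τ ω) ω) ≤ (B e)⁻¹ * (Q[fun ω' => g (X e ω') | G]) ω := by
  have hXe' : X e = B e • discounted B X e := funext fun ω => (mul_discounted hBpos e ω).symm
  have hXi : Integrable (X e) Q := by rw [hXe']; exact hXe.smul _
  have hs := condExp_smul (μ := Q) (B e) (discounted B X e) G
  rw [← hXe'] at hs
  filter_upwards [h, convexOn_Ici_map_condExp_le hG hg (hX e) hXi hge, hs] with ω h1 h2 h3 hA
  rw [← mul_discounted (X := X) hBpos (τ ω) ω]
  refine (inv_mul_comp_mul_le hg hg0 (hBpos _) (hB (he (τ ω)))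
    (discounted_nonneg hBpos hX _ _)).trans ?_
  have h4 : B e * (Q[discounted B X e | G]) ω = (Q[X e | G]) ω := h3.symm
  refine mul_le_mul_of_nonneg_left ((h1 hA).trans ?_) (inv_nonneg.2 (hBpos e).le)
  rw [h4]
  exact h2

/-- Above, `max f (f 0) - f 0` is convex, nonnegative and zero at `0`, so the chain of inequalities
holds for it whatever the slope of `f`. Below, an affine minorant of `f` and the integrability of
the stopped discounted process suffice. -/
theorem integrable_exercisePayoff (hB : Monotone B) (hB1 : ∀ s, 1 ≤ B s)
    (hX : ∀ s ω, 0 ≤ X s ω) (he : ∀ s, s ≤ e) (hXe : Integrable (discounted B X e) Q)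
    (hf : ConvexOn ℝ (Ici 0) f) (hfe : Integrable (fun ω => f (X e ω)) Q) (hτ : Measurable τ)
    (hG : G ≤ mΩ) (hXτ : Integrable (fun ω => discounted B X (τ ω) ω) Q)
    (hle : (fun ω => discounted B X (τ ω) ω) ≤ᵐ[Q] Q[discounted B X e | G]) :
    Integrable (exercisePayoff B X f τ) Q := by
  have hBpos : ∀ s, 0 < B s := fun s => zero_lt_one.trans_le (hB1 s)
  have hinv : ∀ s, (B s)⁻¹ ≤ 1 := fun s => inv_le_one_of_one_le₀ (hB1 s)
  let g : ℝ → ℝ := fun x => max (f x) (f 0) + -f 0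
  have hg : ConvexOn ℝ (Ici 0) g :=
    (hf.sup (convexOn_const (f 0) (convex_Ici 0))).add (convexOn_const (-f 0) (convex_Ici 0))
  have hg0 : g 0 = 0 := by simp [g]
  have hge : Integrable (fun ω => g (X e ω)) Q :=
    (hfe.sup (integrable_const (f 0))).add (integrable_const (-f 0))
  have hgm : MonotoneOn g (Ici 0) := monotoneOn_of_convexOn_of_nonneg hg hg0 fun x _ => by
    have := le_max_right (f x) (f 0)
    simp only [g]
    linarith
  have hup := inv_mul_le_condExp (τ := τ) (A := univ) hB hBpos hX he hXe hG hg hg0 hge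
    ((comp_mul_le_comp_mul_condExp hBpos hX hgm hle).mono fun ω h _ => h)
  obtain ⟨a, b, hb, hab⟩ := exists_affine_le hf
  refine integrable_of_le_of_le
    (Z := fun ω => -|a| - b * discounted B X (τ ω) ω)
    (W := fun ω => (B e)⁻¹ * (Q[fun ω' => g (X e ω') | G]) ω + |f 0|)
    (aestronglyMeasurable_exercisePayoff hB hBpos hX hf hτ hXτ.aestronglyMeasurable)
    ((integrable_const _).sub (hXτ.const_mul b))
    ((integrable_condExp.const_mul _).add (integrable_const _))
    (Eventually.of_forall fun ω => ?_) ?_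
  · have h1 := mul_le_mul_of_nonneg_left (hab _ (hX (τ ω) ω)) (inv_nonneg.2 (hBpos (τ ω)).le)
    refine le_trans ?_ h1
    have h2 : (B (τ ω))⁻¹ * |a| ≤ 1 * |a| := mul_le_mul_of_nonneg_right (hinv _) (abs_nonneg a)
    have h3 : (B (τ ω))⁻¹ * (-|a|) ≤ (B (τ ω))⁻¹ * a :=
      mul_le_mul_of_nonneg_left (neg_abs_le a) (inv_nonneg.2 (hBpos (τ ω)).le)
    simp only [discounted]
    linarith
  · filter_upwards [hup] with ω h
    refine le_trans ?_ (add_le_add_left (h (mem_univ ω)) |f 0|)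
    have h1 : (B (τ ω))⁻¹ * f (X (τ ω) ω) ≤ (B (τ ω))⁻¹ * (g (X (τ ω) ω) + f 0) :=
      mul_le_mul_of_nonneg_left (by simp [g]) (inv_nonneg.2 (hBpos (τ ω)).le)
    have h2 : (B (τ ω))⁻¹ * f 0 ≤ (B (τ ω))⁻¹ * |f 0| :=
      mul_le_mul_of_nonneg_left (le_abs_self _) (inv_nonneg.2 (hBpos (τ ω)).le)
    have h3 : (B (τ ω))⁻¹ * |f 0| ≤ 1 * |f 0| :=
      mul_le_mul_of_nonneg_right (hinv _) (abs_nonneg _)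
    simp only [exercisePayoff]
    linarith

theorem convexOn_sub_affine (hf : ConvexOn ℝ (Ici 0) f) (k c : ℝ) :
    ConvexOn ℝ (Ici 0) fun x => f x - c - k * x := by
  refine ⟨convex_Ici 0, fun x hx y hy a b ha hb hab => ?_⟩
  have h := hf.2 hx hy ha hb hab
  simp only [smul_eq_mul] at h ⊢
  have h' : c = a * c + b * c := by rw [← add_mul, hab, one_mul]
  linarith

/-- The middle inequality of the chain is left as the hypothesis `h` on an event `A`, since it comes
from monotonicity in one case and from equality of the arguments in the other. -/
theorem condExp_exercisePayoff_le (hB : Monotone B) (hBpos : ∀ s, 0 < B s)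
    (hX : ∀ s ω, 0 ≤ X s ω) (he : ∀ s, s ≤ e) (hXe : Integrable (discounted B X e) Q)
    (hf : ConvexOn ℝ (Ici 0) f) (hfe : Integrable (fun ω => f (X e ω)) Q)
    (hτ : ∀ ω, t ≤ τ ω) (hG : G ≤ mΩ) (hGt : ℱ t ≤ G)
    (hXτ : Integrable (fun ω => discounted B X (τ ω) ω) Q)
    (hP : Integrable (exercisePayoff B X f τ) Q)
    (htτ : discounted B X t ≤ᵐ[Q] Q[fun ω => discounted B X (τ ω) ω | ℱ t])
    {k : ℝ} (hk : k ≤ 0) {A : Set Ω} (hA : MeasurableSet[ℱ t] A)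
    (h : ∀ᵐ ω ∂Q, ω ∈ A →
      f (B e * discounted B X (τ ω) ω) - f 0 - k * (B e * discounted B X (τ ω) ω) ≤
      f (B e * (Q[discounted B X e | G]) ω) - f 0 - k * (B e * (Q[discounted B X e | G]) ω)) :
    ∀ᵐ ω ∂Q, ω ∈ A → (Q[exercisePayoff B X f τ | ℱ t]) ω ≤
      europeanValue Q ℱ B X f e t ω + max 0 (f 0) * ((B t)⁻¹ - (B e)⁻¹)
        + k * (discounted B X t ω - (Q[discounted B X e | ℱ t]) ω) := by
  let g : ℝ → ℝ := fun x => f x - f 0 - k * x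
  have hgX : (fun ω => g (X e ω)) =
      fun ω => 1 * f (X e ω) + (-(k * B e)) * discounted B X e ω + -f 0 := by
    ext ω
    simp only [g]
    rw [← mul_discounted (X := X) hBpos e ω]
    ring
  have hge : Integrable (fun ω => g (X e ω)) Q := by
    rw [hgX]
    exact ((hfe.const_mul 1).add (hXe.const_mul _)).add (integrable_const _)
  have hup := inv_mul_le_condExp (τ := τ) (g := g) hB hBpos hX he hXe hG
    (convexOn_sub_affine hf k (f 0)) (by simp [g]) hge h
  set c : ℝ := f 0 * (B e)⁻¹ + max 0 (f 0) * ((B t)⁻¹ - (B e)⁻¹) with hc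
  let R : Ω → ℝ := fun ω =>
    (B e)⁻¹ * (Q[fun ω' => g (X e ω') | G]) ω + k * discounted B X (τ ω) ω + c
  have hR : Integrable R Q :=
    ((integrable_condExp.const_mul _).add (hXτ.const_mul k)).add (integrable_const c)
  have hPR : ∀ᵐ ω ∂Q, ω ∈ A → exercisePayoff B X f τ ω ≤ R ω := by
    filter_upwards [hup] with ω h1 hωA
    have h2 := h1 hωA
    have h3 : f 0 * ((B (τ ω))⁻¹ - (B e)⁻¹) ≤ max 0 (f 0) * ((B t)⁻¹ - (B e)⁻¹) := by
      have e1 : (B e)⁻¹ ≤ (B (τ ω))⁻¹ := inv_anti₀ (hBpos _) (hB (he _))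
      have e2 : (B (τ ω))⁻¹ ≤ (B t)⁻¹ := inv_anti₀ (hBpos _) (hB (hτ ω))
      calc f 0 * ((B (τ ω))⁻¹ - (B e)⁻¹) ≤ max 0 (f 0) * ((B (τ ω))⁻¹ - (B e)⁻¹) :=
            mul_le_mul_of_nonneg_right (le_max_right _ _) (sub_nonneg.2 e1)
        _ ≤ _ := mul_le_mul_of_nonneg_left (by linarith) (le_max_left _ _)
    simp only [exercisePayoff, discounted, R, g, hc] at h2 ⊢
    linarith
  filter_upwards [condExp_mono_on (ℱ.le t) hA hP hR hPR,
    condExp_affine (ℱ.le t) (integrable_condExp (m := G) (f := fun ω => g (X e ω))) hXτ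
      (B e)⁻¹ k c,
    condExp_condExp_of_le (μ := Q) (f := fun ω => g (X e ω)) hGt hG,
    condExp_affine (ℱ.le t) hfe hXe 1 (-(k * B e)) (-f 0), htτ] with ω h1 h2 h3 h4 h5 hωA
  rw [← hgX] at h4
  refine (h1 hωA).trans ?_
  have h2' : (Q[R | ℱ t]) ω = _ := h2
  rw [h2', h3, h4, europeanValue]
  -- Here `k ≤ 0` reverses the optional sampling inequality.
  have h6 := mul_le_mul_of_nonpos_left h5 hk
  have h7 : (B e)⁻¹ * B e = 1 := inv_mul_cancel₀ (hBpos e).ne'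
  rw [hc]
  linear_combination h6 - k * (Q[discounted B X e | ℱ t]) ω * h7

end Bounds

/-! ### Slopes at zero. -/

section RightDerivative

variable {f : ℝ → ℝ}

theorem rightDerivZero_le_slope (hf : ConvexOn ℝ (Ici 0) f) {x : ℝ} (hx : 0 < x) :
    rightDerivZero f ≤ (((f x - f 0) / x : ℝ) : EReal) := by
  refine le_of_tendsto (tendsto_rightDerivZero hf) ?_
  filter_upwards [Ioo_mem_nhdsGT hx] with y hy
  have h := hf.secant_mono (a := 0) (x := y) (y := x) self_mem_Ici
    hy.1.le hx.le hy.1.ne' hx.ne' hy.2.le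
  simp only [sub_zero] at h
  exact EReal.coe_le_coe_iff.2 h

theorem mul_le_sub_of_le_rightDerivZero (hf : ConvexOn ℝ (Ici 0) f) {k : ℝ}
    (hk : (k : EReal) ≤ rightDerivZero f) {x : ℝ} (hx : 0 ≤ x) : k * x ≤ f x - f 0 := by
  rcases hx.eq_or_lt with rfl | hx
  · simp
  · exact (le_div_iff₀ hx).1 (EReal.coe_le_coe_iff.1 (hk.trans (rightDerivZero_le_slope hf hx)))

end RightDerivative

/-! ### The event where the submartingale inequality is an equality. -/

section EqualitySet

variable {Ω : Type*} {m G mΩ : MeasurableSpace Ω} {Q : Measure Ω} [IsProbabilityMeasure Q]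

/-- The gap `Q[Z | G] - Y` is nonnegative, and by the tower property its integral over `A` is at
most that of `Q[Z | m] - U`, which is zero there. -/
theorem ae_eq_condExp_on_of_condExp_eq (hm : m ≤ mΩ) (hmG : m ≤ G) (hG : G ≤ mΩ)
    {U Y Z : Ω → ℝ} (hY : Integrable Y Q) (hUY : U ≤ᵐ[Q] Q[Y | m]) (hYZ : Y ≤ᵐ[Q] Q[Z | G])
    {A : Set Ω} (hA : MeasurableSet[m] A) (hUZ : ∀ ω ∈ A, U ω = (Q[Z | m]) ω) :
    ∀ᵐ ω ∂Q, ω ∈ A → Y ω = (Q[Z | G]) ω := by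
  have hd : Integrable (Q[Z | G] - Y) Q := integrable_condExp.sub hY
  have h0 : 0 ≤ᵐ[Q] Q[Z | G] - Y := by
    filter_upwards [hYZ] with ω h
    exact sub_nonneg.2 h
  have hle : ∫ ω in A, (Q[Z | G] - Y) ω ∂Q ≤ 0 := by
    rw [← setIntegral_condExp hm hd hA]
    refine integral_nonpos_of_ae ((ae_restrict_iff' (hm _ hA)).2 ?_)
    filter_upwards [condExp_sub (integrable_condExp (m := G) (f := Z)) hY m,
      condExp_condExp_of_le (μ := Q) (f := Z) hmG hG, hUY] with ω h1 h2 h3 hωA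
    rw [h1, Pi.sub_apply, h2, ← hUZ ω hωA]
    exact sub_nonpos.2 h3
  have hz := le_antisymm hle (integral_nonneg_of_ae (ae_restrict_of_ae h0))
  rw [setIntegral_eq_zero_iff_of_nonneg_ae (ae_restrict_of_ae h0) hd.integrableOn] at hz
  filter_upwards [(ae_restrict_iff' (hm _ hA)).1 hz] with ω h hωA
  exact (sub_eq_zero.1 (h hωA)).symm

end EqualitySet

end AmericanOption

/-! ### Passage to the essential supremum. -/

theorem proposition1 {Ω : Type*} {mΩ : MeasurableSpace Ω} (Q : Measure Ω) [IsProbabilityMeasure Q]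
    {T : ℝ} (hT : 0 ≤ T) (ℱ : Filtration (Icc (0 : ℝ) T) mΩ)
    (B : Icc (0 : ℝ) T → ℝ) (hB : Monotone B) (hB0 : B ⟨0, left_mem_Icc.2 hT⟩ = 1)
    (X : Icc (0 : ℝ) T → Ω → ℝ) (hX : ∀ s ω, 0 ≤ X s ω)
    (hsub : Submartingale (AmericanOption.discounted B X) ℱ Q)
    (hrc : ∀ᵐ ω ∂Q, ∀ s : Icc (0 : ℝ) T,
      ContinuousWithinAt (fun u => AmericanOption.discounted B X u ω) (Ici s) s)
    (f : ℝ → ℝ) (hf : ConvexOn ℝ (Ici 0) f)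
    (hfT : Integrable (fun ω => f (X ⟨T, right_mem_Icc.2 hT⟩ ω)) Q)
    (t : Icc (0 : ℝ) T) :
    (∀ τ : Ω → Icc (0 : ℝ) T, AmericanOption.IsExerciseTime ℱ t τ →
      Integrable (AmericanOption.exercisePayoff B X f τ) Q) ∧
    ∀ᵐ ω ∂Q, AmericanOption.americanValue Q ℱ B X f t ω ≤
      ((AmericanOption.europeanValue Q ℱ B X f ⟨T, right_mem_Icc.2 hT⟩ t ω
        + max 0 (f 0) * ((B t)⁻¹ - (B ⟨T, right_mem_Icc.2 hT⟩)⁻¹) : ℝ) : EReal)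
      + min 0 (AmericanOption.rightDerivZero f) *
        ((AmericanOption.discounted B X t ω
          - (Q[AmericanOption.discounted B X ⟨T, right_mem_Icc.2 hT⟩ | ℱ t]) ω : ℝ) : EReal) := by
  open AmericanOption in
  set e : Icc (0 : ℝ) T := ⟨T, right_mem_Icc.2 hT⟩
  have he : ∀ s : Icc (0 : ℝ) T, s ≤ e := fun s => s.2.2
  have hB1 : ∀ s, 1 ≤ B s := fun s => hB0 ▸ hB (show (⟨0, left_mem_Icc.2 hT⟩ : Icc (0 : ℝ) T) ≤ s
    from s.2.1)
  have hBpos : ∀ s, 0 < B s := fun s => zero_lt_one.trans_le (hB1 s)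
  have hXe := hsub.integrable e
  have hd0 := fun s ω => discounted_nonneg hBpos hX s ω
  have hint : ∀ τ : Ω → Icc (0 : ℝ) T, IsExerciseTime ℱ t τ →
      Integrable (exercisePayoff B X f τ) Q := fun τ hτ => by
    obtain ⟨G, -, hG, hXτ, hle, -⟩ := exists_sigmaAlgebra_stopped hT hsub hd0 hrc hτ
    exact integrable_exercisePayoff hB hB1 hX he hXe hf hfT hτ.measurable hG hXτ hle
  -- By minimality of the essential supremum, a measurable bound valid for each `τ` separately is
  -- enough.
  refine ⟨hint, (isEssSup_americanValue Q ℱ B X f t).2.2 _ ?_ ?_⟩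
  · have h1 : Measurable (discounted B X t) := ((hsub.1 t).mono (ℱ.le t)).measurable
    have h2 : Measurable (Q[discounted B X e | ℱ t]) :=
      (stronglyMeasurable_condExp.mono (ℱ.le t)).measurable
    have h3 : Measurable (europeanValue Q ℱ B X f e t) :=
      (stronglyMeasurable_condExp.mono (ℱ.le t)).measurable.const_mul _
    exact (measurable_coe_real_ereal.comp (h3.add_const _)).add
      ((measurable_coe_real_ereal.comp (h1.sub h2)).const_mul _)
  · rintro _ ⟨τ, hτ, rfl⟩
    obtain ⟨G, hGt, hG, hXτ, hle, htτ⟩ := exists_sigmaAlgebra_stopped hT hsub hd0 hrc hτ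
    have key := fun (k : ℝ) (hk : k ≤ 0) (A : Set Ω) (hA : MeasurableSet[ℱ t] A) =>
      condExp_exercisePayoff_le hB hBpos hX he hXe hf hfT hτ.2 hG hGt hXτ (hint τ hτ) htτ hk hA
    rcases eq_or_ne (min 0 (rightDerivZero f)) ⊥ with hbot | hbot
    · rw [hbot]
      let A : Set Ω := {ω | discounted B X t ω = (Q[discounted B X e | ℱ t]) ω}
      have hA : MeasurableSet[ℱ t] A :=
        measurableSet_eq_fun (hsub.1 t).measurable stronglyMeasurable_condExp.measurable
      have hAe := ae_eq_condExp_on_of_condExp_eq (ℱ.le t) hGt hG hXτ htτ hle hA fun ω hω => hω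
      have hkey := key 0 le_rfl A hA (by
        filter_upwards [hAe] with ω h hωA
        rw [h hωA])
      filter_upwards [hkey, hsub.ae_le_condExp (he t)] with ω h1 h2
      rcases h2.eq_or_lt with h3 | h3
      · have h4 := h1 h3
        rw [h3, sub_self, EReal.coe_zero, mul_zero, add_zero]
        rw [zero_mul, add_zero] at h4
        exact EReal.coe_le_coe_iff.2 h4
      -- Off the equality event, `-∞` times a negative number makes the bound `+∞`.
      · rw [EReal.bot_mul_coe_of_neg (sub_neg.2 h3), EReal.coe_add_top]
        exact le_top
    · have htop : min 0 (rightDerivZero f) ≠ ⊤ :=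
        ne_top_of_le_ne_top EReal.zero_ne_top (min_le_left _ _)
      obtain ⟨k, hk⟩ : ∃ k : ℝ, (k : EReal) = min 0 (rightDerivZero f) :=
        ⟨_, EReal.coe_toReal htop hbot⟩
      have hk0 : k ≤ 0 := EReal.coe_le_coe_iff.1 (hk.le.trans (min_le_left _ _))
      have hkf : (k : EReal) ≤ rightDerivZero f := hk.le.trans (min_le_right _ _)
      have hmono := monotoneOn_of_convexOn_of_nonneg (convexOn_sub_affine hf k (f 0)) (by simp)
        fun x hx => sub_nonneg.2 (mul_le_sub_of_le_rightDerivZero hf hkf hx)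
      have hkey := key k hk0 univ MeasurableSet.univ
        ((comp_mul_le_comp_mul_condExp hBpos hX hmono hle).mono fun ω h _ => h)
      filter_upwards [hkey] with ω h
      rw [← hk, ← EReal.coe_mul, ← EReal.coe_add]
      exact EReal.coe_le_coe_iff.2 (h (mem_univ ω))
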